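/- A hypergraph $\mathbb H=(V,E)$ consists of hypervertices $V$ and hyperedges $E$, each hyperedge being a nonempty set of hypervertices; hyperedges may repeat, and the union of all hyperedges is $V$. Its associated bipartite graph $B_{\mathbb H}$ has vertex set $V\sqcup E$, with $v\in V$ adjacent to $e\in E$ iff $v\in e$; $\mathbb H$ is connected if $B_{\mathbb H}$ is. The dual $\mathbb H^*$ is obtained by exchanging the roles of $V$ and $E$. The adjacency matrix $A(\mathbb H)$, indexed by $V$, has as $(v,w)$ entry the number of paths of length $2$ without backtracking from $v$ to $w$ in $B_{\mathbb H}$. $\mathbb H$ is $(d,r)$-regular if every hypervertex lies in exactly $d$ hyperedges and every hyperedge contains exactly $r$ hypervertices. Put $\chi(B_{\mathbb H})=|V(B_{\mathbb H})|-|E(B_{\mathbb H})|$. A closed path of length $k\ge 1$ in $\mathbb H$ is a sequence $c=(v_1,e_1,v_2,e_2,\dots,v_k,e_k,v_1)$ with $v_i,v_{i+1}\in e_i$ and $v_i\neq v_{i+1}$ for all $i\in\mathbb Z/k\mathbb Z$. It has hyperedge backtracking if it contains consecutive terms $(e,v,e)$. Let $c^m$ denote $c$ traversed $m$ times. A primitive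 cycle is a closed path $c$ such that neither $c$ nor $c^2$ has hyperedge backtracking and $c\neq b^m$ for every closed path $b$ and every $m\ge 2$. A prime cycle $\mathfrak p$ is a class of primitive cycles under cyclic permutation, and $|\mathfrak p|$ is its length. The zeta function of a finite hypergraph is, for $u\in\mathbb C$ with $|u|$ sufficiently small, $$\zeta_{\mathbb H}(u)=\prod_{\mathfrak p}\bigl(1-u^{|\mathfrak p|}\bigr)^{-1},$$ the product running over all prime cycles $\mathfrak p$ of $\mathbb H$. **Theorem.** Let $\mathbb H$ be a finite, connected, $(d,r)$-regular hypergraph with $d\ge r$. Let $n_1=|V|$, $n_2=|E|$, $q=(d-1)(r-1)$, $A=A(\mathbb H)$ and $A^*=A(\mathbb H^*)$. Then $-\chi(B_{\mathbb H})=n_1(d-1)-n_2=n_2(r-1)-n_1$, and for all $u\in\mathbb C$ with $|u|$ sufficiently small the product defining $\zeta_{\mathbb H}(u)$ converges unconditionally and $$\begin{aligned}\zeta_{\mathbb H}(u)^{-1}&=(1-u)^{-\chi(B_{\mathbb H})}\,(1+(r-1)u)^{n_2-n_1}\,\det\bigl[I_{n_1}-(A-(r-2)I_{n_1})u+qu^2I_{n_1}\bigr]\\&=(1-u)^{-\chi(B_{\mathbb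 H})}\,(1+(d-1)u)^{n_1-n_2}\,\det\bigl[I_{n_2}-(A^*-(d-2)I_{n_2})u+qu^2I_{n_2}\bigr].\end{aligned}$$ -/

import Mathlib

open Filter Topology

/-- A hypergraph with hypervertices `V` and hyperedges indexed by `E`: every hyperedge is a nonempty
set of hypervertices, hyperedges may repeat, and the union of all the hyperedges is `V`. -/
structure MultiHypergraph (V E : Type*) where
  /-- The set of hypervertices contained in a hyperedge. -/
  edge : E → Set V
  edge_nonempty : ∀ e, (edge e).Nonempty
  exists_mem_edge : ∀ v, ∃ e, v ∈ edge e

namespace MultiHypergraph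

/-- The dual hypergraph: hypervertices and hyperedges exchange their roles. -/
def dual {V E : Type*} (H : MultiHypergraph V E) : MultiHypergraph E V where
  edge v := {e | v ∈ H.edge e}
  edge_nonempty := H.exists_mem_edge
  exists_mem_edge := H.edge_nonempty

/-- The associated bipartite graph: a hypervertex and a hyperedge are adjacent when they are
incident, and there are no other adjacencies. -/
def bipartiteGraph {V E : Type*} (H : MultiHypergraph V E) : SimpleGraph (V ⊕ E) where
  Adj
    | Sum.inl v, Sum.inr e => v ∈ H.edge e
    | Sum.inr e, Sum.inl v => v ∈ H.edge e
    | _, _ => False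
  symm := ⟨by rintro (v | e) (w | f) h <;> exact h⟩
  loopless := ⟨by rintro (v | e) h <;> exact h⟩

/-- A hypergraph is connected when its associated bipartite graph is, that is, when any two of its
hypervertices are joined by a path (and there is at least one). -/
def Connected {V E : Type*} (H : MultiHypergraph V E) : Prop :=
  H.bipartiteGraph.Connected

/-- `(d, r)`-regularity: every hypervertex is incident to exactly `d` hyperedges, and every
hyperedge contains exactly `r` hypervertices. -/
def IsRegular {V E : Type*} (H : MultiHypergraph V E) (d r : ℕ) : Prop :=
  (∀ v, {e | v ∈ H.edge e}.ncard = d) ∧ ∀ e, (H.edge e).ncard = r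

/-- The Euler number `|V(B)| - |E(B)|` of the associated bipartite graph `B`. -/
noncomputable def eulerNumber {V E : Type*} (H : MultiHypergraph V E) : ℤ :=
  (Nat.card (V ⊕ E) : ℤ) - (H.bipartiteGraph.edgeSet.ncard : ℤ)

/-- The adjacency matrix: the `(i, j)` entry is the number of directed paths `(i, x, j)` of length
two in the associated bipartite graph with no backtracking. Such a path is given by its middle
vertex `x`, and it backtracks exactly when `i = j`. -/
noncomputable def adjMatrix {V E : Type*} (H : MultiHypergraph V E) : Matrix V V ℂ :=
  Matrix.of fun i j =>
    (({x | H.bipartiteGraph.Adj (Sum.inl i) x ∧ H.bipartiteGraph.Adj x (Sum.inl j) ∧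
      i ≠ j} : Set (V ⊕ E)).ncard : ℂ)

/-! A closed path `(v₁, e₁, v₂, e₂, …, vₖ, eₖ, v₁)` of length `k ≥ 1` is represented by the list
`[(v₁, e₁), …, (vₖ, eₖ)]`. -/

/-- One step `(v, e, w)` of a path, where `a = (v, e)` and `w` is the first entry of `b`:
the hyperedge `e` is used to pass from `v` to a different hypervertex `w`. -/
def IsStep {V E : Type*} (H : MultiHypergraph V E) (a b : V × E) : Prop :=
  a.1 ∈ H.edge a.2 ∧ b.1 ∈ H.edge a.2 ∧ a.1 ≠ b.1

/-- Closed paths: every entry, the last one followed by the first one, makes a step to the next. -/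
def IsClosedPath {V E : Type*} (H : MultiHypergraph V E) (c : List (V × E)) : Prop :=
  c ≠ [] ∧ (c : Cycle (V × E)).Chain H.IsStep

/-- The `m`-multiple `c ^ m`, going `m` times around `c`. -/
def multiple {V E : Type*} (m : ℕ) (c : List (V × E)) : List (V × E) :=
  (List.replicate m c).flatten

/-- The sequence `(v₁, e₁, …, vₖ, eₖ, v₁)` has no consecutive entries of the form `(e, v, e)`. -/
def NoHyperedgeBacktracking {V E : Type*} (c : List (V × E)) : Prop :=
  c.IsChain fun a b => a.2 ≠ b.2

/-- Primitive cycles: closed paths without hyperedge backtracking, tail-less (the double `c ^ 2` has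
no hyperedge backtracking), and not a nontrivial multiple of another closed path. -/
def IsPrimitiveCycle {V E : Type*} (H : MultiHypergraph V E) (c : List (V × E)) : Prop :=
  H.IsClosedPath c ∧ NoHyperedgeBacktracking c ∧ NoHyperedgeBacktracking (multiple 2 c) ∧
    ∀ (b : List (V × E)) (m : ℕ), H.IsClosedPath b → 2 ≤ m → c ≠ multiple m b

/-- Prime cycles: classes of primitive cycles under cyclic permutation (direction matters). -/
def PrimeCycle {V E : Type*} (H : MultiHypergraph V E) : Type _ :=
  {C : Cycle (V × E) // ∃ c : List (V × E), (c : Cycle (V × E)) = C ∧ H.IsPrimitiveCycle c}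

/-- The length of a prime cycle. -/
def PrimeCycle.length {V E : Type*} {H : MultiHypergraph V E} (p : H.PrimeCycle) : ℕ :=
  Cycle.length p.1

/-- The generalized Ihara-Selberg zeta function, as an Euler product over the prime cycles; it is
meaningful where the product converges, in particular for small `|u|`. -/
noncomputable def zeta {V E : Type*} (H : MultiHypergraph V E) (u : ℂ) : ℂ :=
  ∏' p : H.PrimeCycle, (1 - u ^ p.length)⁻¹

end MultiHypergraph

/-!
The inverse of the zeta function is the determinant of `1 - u T`, where `T` is the 0-1 matrix of the
relation "`(w, f)` may follow `(v, e)` in a closed path without hyperedge backtracking" on pairs of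
a hypervertex and a hyperedge; the regularity of the hypergraph then reduces this determinant to one
of the size of the hypervertices, or of the hyperedges.

*Euler product* (`eventually_hasProd_prime`, for any relation on a finite type). For small `u`,
`-log det (1 - u T) = ∑ tr (T ^ n) u ^ n / n`, which is seen on the eigenvalues of `T`
(`Matrix.eventually_hasSum_trace_pow`). Since `tr (T ^ n)` counts the closed paths of length `n`,
this is the absolutely convergent sum of `u ^ |c| / |c|` over all closed paths `c`
(`hasSum_closedPathTerm`). Every nonempty word is a power of a unique primitive word
(`List.primitivePowerEquiv`), so for each primitive closed path `b` the powers of `b` contribute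
`-log (1 - u ^ |b|) / |b|` (`hasSum_neg_log_primitive`). A primitive word has exactly `|b|` different
rotations (`List.IsPrimitive.card_isRotated`), so that a prime cycle `p` contributes
`-log (1 - u ^ |p|)` (`hasSum_neg_log_prime`). Exponentiating gives the unconditionally convergent
product. The facts about words rest on the rotation by one place, as a dynamical system on words: a
word is primitive exactly when its minimal period is its length.

*Determinant* (`Matrix.det_one_sub_smul_mul_sub_one`). Restricted to the incident pairs, `T` is
`(M Mᵀ - 1) (N Nᵀ - 1)`, where `M` and `N` are the incidence matrices of the incident pairs with the
hyperedges and with the hypervertices. Regularity says that `Mᵀ M = r` and `Nᵀ N = d`, and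
`B = Nᵀ M` is the incidence matrix of the hypergraph. Two applications of
`det (1 - X Y) = det (1 - Y X)` turn `det (1 - u T)` into a multiple of
`det ((1 + (d - 1) u) (1 + (r - 1) u) - u B Bᵀ)`, and `B Bᵀ = A + d`. A third application exchanges
`B Bᵀ` for `Bᵀ B = A* + r`, which gives the formula for the dual.
-/

open scoped Matrix

/-! ### Primitive words -/

namespace List

variable {α : Type*}

/-- A nonempty word is primitive when it is not a proper power of another word. -/
def IsPrimitive (c : List α) : Prop :=
  c ≠ [] ∧ ∀ (b : List α) (m : ℕ), 2 ≤ m → c ≠ (replicate m b).flatten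

/-- The smallest positive number of places by which a word can be rotated without changing it. -/
noncomputable def rotationPeriod (c : List α) : ℕ :=
  Function.minimalPeriod (fun l : List α => l.rotate 1) c

theorem iterate_rotate_one (c : List α) (n : ℕ) :
    (fun l : List α => l.rotate 1)^[n] c = c.rotate n := by
  induction n with
  | zero => simp
  | succ n ih => rw [Function.iterate_succ_apply', ih, rotate_rotate]

theorem isPeriodicPt_rotate_one_iff {c : List α} {n : ℕ} :
    Function.IsPeriodicPt (fun l : List α => l.rotate 1) n c ↔ c.rotate n = c := by
  rw [Function.IsPeriodicPt, Function.IsFixedPt, iterate_rotate_one]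

theorem rotationPeriod_dvd_length (c : List α) : c.rotationPeriod ∣ c.length :=
  (isPeriodicPt_rotate_one_iff.2 c.rotate_length).minimalPeriod_dvd

theorem rotate_rotationPeriod (c : List α) : c.rotate c.rotationPeriod = c :=
  isPeriodicPt_rotate_one_iff.1 (Function.isPeriodicPt_minimalPeriod _ c)

theorem length_flatten_replicate (m : ℕ) (c : List α) :
    (replicate m c).flatten.length = m * c.length := by
  simp

theorem flatten_replicate_succ (m : ℕ) (c : List α) :
    (replicate (m + 1) c).flatten = c ++ (replicate m c).flatten := by
  simp [replicate_succ]

theorem flatten_replicate_cons_append_singleton (m : ℕ) (x : α) (t : List α) :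
    (replicate m (x :: t)).flatten ++ [x] = x :: (replicate m (t ++ [x])).flatten := by
  induction m with
  | zero => simp
  | succ m ih =>
    rw [flatten_replicate_succ, flatten_replicate_succ, append_assoc, ih]
    simp

theorem flatten_replicate_rotate (m : ℕ) (c : List α) (n : ℕ) :
    (replicate m c).flatten.rotate n = (replicate m (c.rotate n)).flatten := by
  have one (c : List α) :
      (replicate m c).flatten.rotate 1 = (replicate m (c.rotate 1)).flatten := by
    cases c with
    | nil => simp
    | cons x t =>
      cases m with
      | zero => simp
      | succ m =>
        rw [flatten_replicate_succ, cons_append, rotate_cons_succ, rotate_zero, append_assoc,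
          flatten_replicate_cons_append_singleton, rotate_cons_succ, rotate_zero,
          flatten_replicate_succ]
        simp
  induction n generalizing c with
  | zero => simp
  | succ n ih =>
    rw [Nat.add_comm, ← rotate_rotate, one, ih, rotate_rotate]

theorem flatten_replicate_injective {m : ℕ} (hm : m ≠ 0) :
    Function.Injective fun c : List α => (replicate m c).flatten := by
  intro b c h
  have hl : b.length = c.length := by
    have := congrArg length h
    simpa [hm] using this
  obtain ⟨k, rfl⟩ := Nat.exists_eq_succ_of_ne_zero hm
  simp only [Nat.succ_eq_add_one, flatten_replicate_succ] at h
  exact (append_inj h hl).1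

theorem rotationPeriod_flatten_replicate {m : ℕ} (hm : m ≠ 0) (c : List α) :
    (replicate m c).flatten.rotationPeriod = c.rotationPeriod := by
  refine Function.minimalPeriod_eq_minimalPeriod_iff.2 fun n => ?_
  rw [isPeriodicPt_rotate_one_iff, isPeriodicPt_rotate_one_iff, flatten_replicate_rotate]
  exact (flatten_replicate_injective hm).eq_iff

/-- A word commuting with `w`, of length a multiple of that of `w`, is a power of `w`: strip copies
of `w` from the front. -/
theorem eq_flatten_replicate_of_append_comm {w : List α} {k : ℕ} {d : List α}
    (h : w ++ d = d ++ w) (hd : d.length = k * w.length) : d = (replicate k w).flatten := by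
  induction k generalizing d with
  | zero => simpa using hd
  | succ k ih =>
    have hwd : w <+: d :=
      prefix_of_prefix_length_le (prefix_append w d) (h ▸ prefix_append d w)
        (by rw [hd]; exact Nat.le_mul_of_pos_left _ k.succ_pos)
    obtain ⟨e, rfl⟩ := hwd
    rw [append_assoc] at h
    rw [flatten_replicate_succ, ← ih (append_cancel_left h)
      (by rw [length_append] at hd; linarith)]

theorem eq_flatten_replicate_of_rotate_eq {c : List α} {n m : ℕ} (h : c.rotate n = c)
    (hc : c.length = n * m) : c = (replicate m (c.take n)).flatten := by
  cases m with
  | zero => simpa using hc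
  | succ m =>
    have hn : n ≤ c.length := by rw [hc]; exact Nat.le_mul_of_pos_right _ m.succ_pos
    have hlen : (c.take n).length = n := by simp [hn]
    rw [rotate_eq_drop_append_take hn] at h
    have hcomm : c.take n ++ c.drop n = c.drop n ++ c.take n := by
      rw [take_append_drop, h]
    have := eq_flatten_replicate_of_append_comm (k := m) hcomm
      (by rw [hlen, length_drop, hc, Nat.mul_succ, Nat.add_sub_cancel, Nat.mul_comm])
    rw [flatten_replicate_succ, ← this, take_append_drop]

/-- Every word is a power of its initial segment of length the rotation period. -/
theorem eq_flatten_replicate_rotationPeriod (c : List α) :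
    c = (replicate (c.length / c.rotationPeriod) (c.take c.rotationPeriod)).flatten :=
  eq_flatten_replicate_of_rotate_eq c.rotate_rotationPeriod
    (Nat.mul_div_cancel' c.rotationPeriod_dvd_length).symm

theorem isPrimitive_iff {c : List α} :
    c.IsPrimitive ↔ c ≠ [] ∧ c.rotationPeriod = c.length := by
  refine and_congr_right fun hc => ⟨fun h => ?_, ?_⟩
  · have hpos : 0 < c.length := length_pos_iff.2 hc
    obtain ⟨m, hm⟩ := c.rotationPeriod_dvd_length
    rcases Nat.lt_or_ge m 2 with h2 | h2
    · interval_cases m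
      · omega
      · omega
    · exact absurd (eq_flatten_replicate_of_rotate_eq c.rotate_rotationPeriod hm) (h _ _ h2)
  · rintro h b m hm rfl
    rw [rotationPeriod_flatten_replicate (by omega), length_flatten_replicate] at h
    have hb : 0 < b.length := by
      rw [length_pos_iff]
      rintro rfl
      simp at hc
    have := Nat.le_of_dvd hb b.rotationPeriod_dvd_length
    nlinarith

theorem IsPrimitive.length_pos {c : List α} (hc : c.IsPrimitive) : 0 < c.length :=
  length_pos_iff.2 hc.1

theorem IsPrimitive.rotate {c : List α} (hc : c.IsPrimitive) (n : ℕ) :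
    (c.rotate n).IsPrimitive := by
  rw [isPrimitive_iff] at hc ⊢
  refine ⟨by simpa using hc.1, ?_⟩
  rw [length_rotate, ← hc.2, rotationPeriod, ← iterate_rotate_one]
  exact Function.minimalPeriod_apply_iterate
    (Function.mk_mem_periodicPts (length_pos_iff.2 hc.1)
      (isPeriodicPt_rotate_one_iff.2 c.rotate_length)) n

/-- Every nonempty word is a positive power of a unique primitive word. Here `p` is a property of
words that holds for a positive power exactly when it holds for the base. -/
noncomputable def primitivePowerEquiv (p : List α → Prop)
    (hp : ∀ (b : List α) (m : ℕ), p (replicate (m + 1) b).flatten ↔ p b) :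
    {b : List α // p b ∧ b.IsPrimitive} × ℕ ≃ {c : List α // p c ∧ c ≠ []} :=
  Equiv.ofBijective
    (fun x => ⟨(replicate (x.2 + 1) x.1.1).flatten, (hp _ _).2 x.1.2.1, by
      rw [flatten_replicate_succ]
      simp [x.1.2.2.1]⟩) <| by
    constructor
    · rintro ⟨⟨b, hb, hb'⟩, m⟩ ⟨⟨c, hc, hc'⟩, n⟩ h
      replace h : (replicate (m + 1) b).flatten = (replicate (n + 1) c).flatten :=
        congrArg Subtype.val h
      have hl : b.length = c.length := by
        rw [← (isPrimitive_iff.1 hb').2, ← (isPrimitive_iff.1 hc').2,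
          ← rotationPeriod_flatten_replicate m.succ_ne_zero b, h,
          rotationPeriod_flatten_replicate n.succ_ne_zero c]
      have hmn : m = n := by
        have := congrArg length h
        rw [length_flatten_replicate, length_flatten_replicate, hl] at this
        exact Nat.succ_injective (Nat.eq_of_mul_eq_mul_right hc'.length_pos this)
      subst hmn
      have := flatten_replicate_injective m.succ_ne_zero h
      subst this
      rfl
    · rintro ⟨c, hc, hc'⟩
      have hpos : 0 < c.length := length_pos_iff.2 hc'
      have hper : 0 < c.rotationPeriod := Nat.pos_of_dvd_of_pos c.rotationPeriod_dvd_length hpos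
      have hle := Nat.le_of_dvd hpos c.rotationPeriod_dvd_length
      obtain ⟨m, hm⟩ := Nat.exists_eq_succ_of_ne_zero (Nat.div_pos hle hper).ne'
      have hcm := c.eq_flatten_replicate_rotationPeriod
      rw [hm] at hcm
      refine ⟨⟨⟨c.take c.rotationPeriod, ?_, ?_⟩, m⟩, Subtype.ext hcm.symm⟩
      · rwa [← hp _ m, ← hcm]
      · rw [isPrimitive_iff]
        refine ⟨by simp [hc', hper.ne'], ?_⟩
        rw [← rotationPeriod_flatten_replicate m.succ_ne_zero, ← hcm, length_take,
          min_eq_left hle]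

theorem coe_primitivePowerEquiv (p : List α → Prop)
    (hp : ∀ (b : List α) (m : ℕ), p (replicate (m + 1) b).flatten ↔ p b)
    (x : {b : List α // p b ∧ b.IsPrimitive} × ℕ) :
    (primitivePowerEquiv p hp x : List α) = (replicate (x.2 + 1) x.1.1).flatten :=
  rfl

/-- The rotations of a primitive word by fewer places than its length are all different. -/
theorem IsPrimitive.card_isRotated {c : List α} (hc : c.IsPrimitive) :
    Nat.card {b : List α // b ~r c} = c.length := by
  have hbij : Function.Bijective fun i : Fin c.length =>
      (⟨c.rotate i, IsRotated.forall c i⟩ : {b : List α // b ~r c}) := by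
    constructor
    · intro i j h
      replace h : c.rotate i = c.rotate j := congrArg Subtype.val h
      rw [← iterate_rotate_one, ← iterate_rotate_one] at h
      have hper := (isPrimitive_iff.1 hc).2
      exact Fin.ext ((Function.iterate_eq_iterate_iff_of_lt_minimalPeriod
        (i.2.trans_eq hper.symm) (j.2.trans_eq hper.symm)).1 h)
    · rintro ⟨b, hb⟩
      obtain ⟨n, rfl⟩ := hb.symm
      exact ⟨⟨n % c.length, Nat.mod_lt _ hc.length_pos⟩, Subtype.ext (c.rotate_mod n)⟩
  rw [← Nat.card_congr (Equiv.ofBijective _ hbij), Nat.card_fin]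

theorem IsChain.flatten_replicate_append_iff {R : α → α → Prop} (x : α) (t : List α) (m : ℕ) :
    IsChain R ((replicate (m + 1) (x :: t)).flatten ++ [x]) ↔ IsChain R (x :: t ++ [x]) := by
  induction m with
  | zero => simp
  | succ m ih =>
    have : (replicate (m + 1 + 1) (x :: t)).flatten ++ [x] =
        x :: t ++ x :: (t ++ (replicate m (x :: t)).flatten ++ [x]) := by
      rw [flatten_replicate_succ, flatten_replicate_succ]
      simp
    rw [this, isChain_split]
    rw [flatten_replicate_succ] at ih
    simp only [cons_append, append_assoc] at ih ⊢
    rw [ih, and_self]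

end List

theorem Cycle.chain_coe_flatten_replicate {α : Type*} {R : α → α → Prop} (b : List α) (m : ℕ) :
    Cycle.Chain R ((List.replicate (m + 1) b).flatten : Cycle α) ↔
      Cycle.Chain R (b : Cycle α) := by
  cases b with
  | nil => simp
  | cons x t =>
    rw [Cycle.chain_coe_cons, ← List.cons_append, ← List.IsChain.flatten_replicate_append_iff x t m,
      List.flatten_replicate_succ, List.cons_append, Cycle.chain_coe_cons]
    simp only [List.cons_append]

/-! ### Traces of powers and the characteristic polynomial -/

namespace Matrix

open Polynomial

variable {ι : Type*} [Fintype ι] [DecidableEq ι]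

/-- The determinant of `p A` is the product of the values of `p` at the eigenvalues of `A`. -/
theorem det_aeval_eq_prod_roots_charpoly {K : Type*} [Field K] [IsAlgClosed K]
    (A : Matrix ι ι K) (p : K[X]) :
    (aeval A p).det = (A.charpoly.roots.map fun x => p.eval x).prod := by
  have hcard : Multiset.card A.charpoly.roots = Fintype.card ι := by
    rw [← A.charpoly_natDegree_eq_dim, (IsAlgClosed.splits A.charpoly).natDegree_eq_card_roots]
  have hlin (x : K) :
      (aeval A (X - C x)).det = (A.charpoly.roots.map fun y => (X - C x).eval y).prod := by
    have h1 : aeval A (X - C x) = -(scalar ι x - A) := by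
      simp [algebraMap_eq_diagonal, Pi.algebraMap_def]
    have h2 : (A.charpoly.roots.map fun y => (X - C x).eval y) =
        (A.charpoly.roots.map fun y => -(x - y)) := by
      simp
    have h3 := Multiset.prod_map_neg (A.charpoly.roots.map fun y => x - y)
    rw [Multiset.map_map, Multiset.card_map, hcard] at h3
    rw [h1, det_neg, ← eval_charpoly, h2,
      (IsAlgClosed.splits A.charpoly).eval_eq_prod_roots_of_monic A.charpoly_monic]
    exact h3.symm
  have hprod (s : Multiset K) : (aeval A (s.map fun x => X - C x).prod).det =
      (A.charpoly.roots.map fun y => ((s.map fun x => X - C x).prod).eval y).prod := by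
    induction s using Multiset.induction_on with
    | empty => simp
    | cons x s ih =>
      rw [Multiset.map_cons, Multiset.prod_cons, map_mul, det_mul, ih, hlin]
      simp only [eval_mul, Multiset.prod_map_mul]
  rw [(IsAlgClosed.splits p).eq_prod_roots, map_mul, det_mul, hprod, aeval_C,
    algebraMap_eq_diagonal, Pi.algebraMap_def, det_diagonal]
  simp only [eval_mul, eval_C, Multiset.prod_map_mul]
  simp [hcard]

/-- The value of the characteristic polynomial of `A ^ k` at `z` is `det (p A)` for
`p = z - X ^ k`. -/
theorem roots_charpoly_pow {K : Type*} [Field K] [IsAlgClosed K] (A : Matrix ι ι K) (k : ℕ) :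
    (A ^ k).charpoly.roots = A.charpoly.roots.map fun x => x ^ k := by
  have : (A ^ k).charpoly = ((A.charpoly.roots.map fun x => x ^ k).map fun x => X - C x).prod := by
    have := IsAlgClosed.instInfinite (K := K)
    refine Polynomial.funext fun z => ?_
    have h := A.det_aeval_eq_prod_roots_charpoly (C z - X ^ k)
    rw [map_sub, aeval_C, map_pow, aeval_X] at h
    rw [eval_charpoly, eval_multiset_prod, Multiset.map_map, Multiset.map_map]
    simpa [algebraMap_eq_diagonal, Pi.algebraMap_def, Function.comp_def] using h
  rw [this, roots_multiset_prod_X_sub_C]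

theorem trace_pow_eq_sum_roots_charpoly {K : Type*} [Field K] [IsAlgClosed K]
    (A : Matrix ι ι K) (k : ℕ) :
    (A ^ k).trace = (A.charpoly.roots.map fun x => x ^ k).sum := by
  rw [trace_eq_sum_roots_charpoly, roots_charpoly_pow]

theorem det_one_sub_smul_eq_prod_roots_charpoly {K : Type*} [Field K] [IsAlgClosed K]
    (A : Matrix ι ι K) (u : K) :
    (1 - u • A).det = (A.charpoly.roots.map fun x => 1 - u * x).prod := by
  have h := A.det_aeval_eq_prod_roots_charpoly (1 - C u * X)
  simpa [← Algebra.smul_def] using h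

/-- The expansion `-log det (1 - u A) = ∑ tr (A ^ n) u ^ n / n` for small `u`. The term at `n = 0`
is zero, being a quotient by zero. -/
theorem eventually_hasSum_trace_pow (A : Matrix ι ι ℂ) :
    ∀ᶠ u : ℂ in 𝓝 0, ∃ L : ℂ,
      HasSum (fun n : ℕ => (A ^ n).trace * (u ^ n / n)) L ∧
        Complex.exp L = (1 - u • A).det⁻¹ := by
  have hsmall : ∀ᶠ u : ℂ in 𝓝 0, ∀ x ∈ A.charpoly.roots.toFinset, ‖u * x‖ < 1 := by
    rw [Filter.eventually_all_finset]
    intro x _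
    have hc : Tendsto (fun u : ℂ => ‖u * x‖) (𝓝 0) (𝓝 ‖(0 : ℂ) * x‖) :=
      (Continuous.tendsto (by fun_prop) 0)
    rw [zero_mul, norm_zero] at hc
    exact hc.eventually_lt_const one_pos
  filter_upwards [hsmall] with u hu
  rw [det_one_sub_smul_eq_prod_roots_charpoly]
  simp only [trace_pow_eq_sum_roots_charpoly]
  replace hu : ∀ x ∈ A.charpoly.roots, ‖u * x‖ < 1 := by simpa only [Multiset.mem_toFinset] using hu
  generalize A.charpoly.roots = s at hu
  induction s using Multiset.induction_on with
  | empty => exact ⟨0, by simp, by simp⟩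
  | cons x s ih =>
    obtain ⟨L, hL, hexp⟩ := ih fun y hy => hu y (Multiset.mem_cons_of_mem hy)
    have hx := hu x (Multiset.mem_cons_self x s)
    refine ⟨-Complex.log (1 - u * x) + L, ?_, ?_⟩
    · refine ((Complex.hasSum_taylorSeries_neg_log hx).add hL).congr_fun ?_
      intro n
      rw [Multiset.map_cons, Multiset.sum_cons, mul_pow]
      ring
    · have h0 : 1 - u * x ≠ 0 := by
        intro h
        rw [← sub_eq_zero.1 h, norm_one] at hx
        exact lt_irrefl _ hx
      rw [Complex.exp_add, hexp, Complex.exp_neg, Complex.exp_log h0, Multiset.map_cons,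
        Multiset.prod_cons, mul_inv]

end Matrix

/-! ### The Euler product over the prime cycles of a relation -/

section Relation

variable {α : Type*} (R : α → α → Prop)

/-- The prime cycles of a relation: cyclic words whose consecutive letters are related and which
are represented by primitive words. -/
abbrev Cycle.Prime : Type _ :=
  {C : Cycle α // Cycle.Chain R C ∧ ∃ c : List α, (c : Cycle α) = C ∧ c.IsPrimitive}

/-- The 0-1 matrix of a relation, over the complex numbers. -/
def relMatrix [DecidableRel R] : Matrix α α ℂ :=
  Matrix.of fun a b => if R a b then 1 else 0

open Classical in
/-- The closed path `c` contributes `u ^ |c| / |c|` to the logarithm of the zeta function. Words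
that are not closed paths contribute zero, and so does the empty word, by division by zero. -/
noncomputable def closedPathTerm (u : ℂ) (c : List α) : ℂ :=
  if Cycle.Chain R (c : Cycle α) then u ^ c.length / c.length else 0

variable {R}

theorem ofFn_consEquiv {k : ℕ} (x : α) (f : Fin k → α) :
    List.ofFn (Fin.consEquiv (fun _ : Fin (k + 1) => α) (x, f)) = x :: List.ofFn f :=
  List.ofFn_cons x f

/-- The entries of the powers count walks, which are listed by their `k` interior letters. -/
theorem relMatrix_pow_succ_apply [Fintype α] [DecidableEq α] [DecidableRel R] (k : ℕ) (a b : α) :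
    (relMatrix R ^ (k + 1)) a b =
      ∑ f : Fin k → α, if List.IsChain R (a :: (List.ofFn f ++ [b])) then 1 else 0 := by
  induction k generalizing a with
  | zero => simp [relMatrix]
  | succ k ih =>
    rw [pow_succ', Matrix.mul_apply, ← (Fin.consEquiv fun _ : Fin (k + 1) => α).sum_comp,
      Fintype.sum_prod_type]
    refine Finset.sum_congr rfl fun x _ => ?_
    rw [ih, Finset.mul_sum]
    refine Finset.sum_congr rfl fun f _ => ?_
    simp only [ofFn_consEquiv, List.cons_append, List.isChain_cons_cons, relMatrix,
      Matrix.of_apply, ite_and, ite_mul, one_mul, zero_mul]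

theorem trace_relMatrix_pow_mul [Fintype α] [DecidableEq α] [DecidableRel R] (u : ℂ) (k : ℕ) :
    ∑ f : Fin k → α, closedPathTerm R u (List.ofFn f) =
      (relMatrix R ^ k).trace * (u ^ k / k) := by
  cases k with
  | zero => simp [closedPathTerm]
  | succ k =>
    rw [← (Fin.consEquiv fun _ : Fin (k + 1) => α).sum_comp, Fintype.sum_prod_type, Matrix.trace,
      Finset.sum_mul]
    refine Finset.sum_congr rfl fun x _ => ?_
    rw [Matrix.diag_apply, relMatrix_pow_succ_apply, Finset.sum_mul]
    refine Finset.sum_congr rfl fun f _ => ?_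
    rw [ofFn_consEquiv, closedPathTerm, Cycle.chain_coe_cons, List.length_cons, List.length_ofFn]
    split_ifs <;> simp

theorem norm_closedPathTerm_le (u : ℂ) (c : List α) :
    ‖closedPathTerm R u c‖ ≤ ‖u‖ ^ c.length := by
  unfold closedPathTerm
  split_ifs
  · rcases Nat.eq_zero_or_pos c.length with h | h
    · simp [h]
    · rw [norm_div, norm_pow, Complex.norm_natCast]
      exact div_le_self (by positivity) (by exact_mod_cast h)
  · simp

theorem summable_closedPathTerm [Fintype α] {u : ℂ} (hu : ‖u‖ * Fintype.card α < 1) :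
    Summable (closedPathTerm R u) := by
  rw [← List.equivSigmaTuple.symm.summable_iff]
  refine Summable.of_norm_bounded (g := fun f : Σ n, Fin n → α => ‖u‖ ^ f.1) ?_ ?_
  · rw [summable_sigma_of_nonneg fun f => by positivity]
    refine ⟨fun n => Summable.of_finite, ?_⟩
    refine (summable_geometric_of_lt_one (by positivity) hu).congr fun n => ?_
    rw [tsum_fintype]
    simp [mul_pow, mul_comm]
  · rintro ⟨n, f⟩
    simpa [List.equivSigmaTuple] using norm_closedPathTerm_le (R := R) u (List.ofFn f)

theorem hasSum_closedPathTerm [Fintype α] [DecidableEq α] [DecidableRel R] {u L : ℂ}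
    (hu : ‖u‖ * Fintype.card α < 1)
    (hL : HasSum (fun n : ℕ => (relMatrix R ^ n).trace * (u ^ n / n)) L) :
    HasSum (closedPathTerm R u) L := by
  rw [← List.equivSigmaTuple.symm.hasSum_iff]
  refine HasSum.sigma_of_hasSum hL (fun n => ?_)
    (List.equivSigmaTuple.symm.summable_iff.2 (summable_closedPathTerm hu))
  rw [← trace_relMatrix_pow_mul]
  exact hasSum_fintype _

/-- Grouping the closed paths by their primitive roots turns the sum over closed paths into a sum
of logarithms over primitive closed paths. -/
theorem hasSum_neg_log_primitive {u L : ℂ} (hu : ‖u‖ < 1)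
    (hL : HasSum (closedPathTerm R u) L) :
    HasSum (fun b : {b : List α // Cycle.Chain R (b : Cycle α) ∧ b.IsPrimitive} =>
      -Complex.log (1 - u ^ b.1.length) / b.1.length) L := by
  let p : List α → Prop := fun c => Cycle.Chain R (c : Cycle α)
  have hsub : HasSum (fun c : {c : List α // p c ∧ c ≠ []} => closedPathTerm R u c) L := by
    refine (Function.Injective.hasSum_iff Subtype.val_injective fun c hc => ?_).2 hL
    rw [Subtype.range_coe_subtype, Set.mem_ofPred_eq, not_and_or, not_not] at hc
    rcases hc with hc | rfl
    · exact if_neg hc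
    · simp [closedPathTerm]
  rw [← (List.primitivePowerEquiv p Cycle.chain_coe_flatten_replicate).hasSum_iff] at hsub
  refine hsub.prod_fiberwise fun b => ?_
  have hb : ‖u ^ b.1.length‖ < 1 := by
    rw [norm_pow]
    exact pow_lt_one₀ (norm_nonneg u) hu b.2.2.length_pos.ne'
  refine ((Complex.hasSum_taylorSeries_neg_log' hb).div_const _).congr_fun fun m => ?_
  have hp : Cycle.Chain R ((List.replicate (m + 1) b.1).flatten : Cycle α) :=
    (Cycle.chain_coe_flatten_replicate _ _).2 b.2.1
  rw [Function.comp_apply, List.coe_primitivePowerEquiv, closedPathTerm, if_pos hp,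
    List.length_flatten_replicate, div_div, ← pow_mul, Nat.mul_comm]
  push_cast
  rw [mul_comm (b.1.length : ℂ)]

/-- The `|p|` primitive words that represent a prime cycle `p` contribute one logarithm. -/
theorem hasSum_neg_log_prime {u L : ℂ}
    (hL : HasSum (fun b : {b : List α // Cycle.Chain R (b : Cycle α) ∧ b.IsPrimitive} =>
      -Complex.log (1 - u ^ b.1.length) / b.1.length) L) :
    HasSum (fun p : Cycle.Prime R => -Complex.log (1 - u ^ p.1.length)) L := by
  let π : {b : List α // Cycle.Chain R (b : Cycle α) ∧ b.IsPrimitive} → Cycle.Prime R :=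
    fun b => ⟨(b.1 : Cycle α), b.2.1, b.1, rfl, b.2.2⟩
  rw [← (Equiv.sigmaFiberEquiv π).hasSum_iff] at hL
  refine hL.sigma ?_
  rintro ⟨_, hc, c, rfl, hprim⟩
  have e : {b // π b = ⟨(c : Cycle α), hc, c, rfl, hprim⟩} ≃ {b : List α // b ~r c} :=
    { toFun := fun b => ⟨b.1.1, Cycle.coe_eq_coe.1 (congrArg Subtype.val b.2)⟩
      invFun := fun b => ⟨⟨b.1, by rwa [Cycle.coe_eq_coe.2 b.2], by
        obtain ⟨n, hn⟩ := b.2.symm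
        exact hn ▸ hprim.rotate n⟩, Subtype.ext (Cycle.coe_eq_coe.2 b.2)⟩
      left_inv := fun _ => rfl
      right_inv := fun _ => rfl }
  have hcard := (Nat.card_congr e).trans hprim.card_isRotated
  have : Finite {b // π b = ⟨(c : Cycle α), hc, c, rfl, hprim⟩} :=
    Nat.finite_of_card_ne_zero (hcard ▸ hprim.length_pos.ne')
  have := Fintype.ofFinite {b // π b = ⟨(c : Cycle α), hc, c, rfl, hprim⟩}
  rw [Nat.card_eq_fintype_card] at hcard
  have hconst : ∀ b : {b // π b = ⟨(c : Cycle α), hc, c, rfl, hprim⟩},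
      -Complex.log (1 - u ^ b.1.1.length) / b.1.1.length =
        -Complex.log (1 - u ^ c.length) / c.length := fun b => by
    rw [← Cycle.length_coe b.1.1, show (b.1.1 : Cycle α) = c from congrArg Subtype.val b.2,
      Cycle.length_coe]
  convert! hasSum_fintype _ using 1
  have hsum : ∑ b : {b // π b = ⟨(c : Cycle α), hc, c, rfl, hprim⟩},
      -Complex.log (1 - u ^ b.1.1.length) / b.1.1.length = -Complex.log (1 - u ^ c.length) := by
    rw [Finset.sum_congr rfl fun b _ => hconst b, Finset.sum_const, Finset.card_univ, hcard,
      nsmul_eq_mul, mul_div_cancel₀ _ (Nat.cast_ne_zero.2 hprim.length_pos.ne')]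
  exact hsum.symm

/-- The Euler product over the prime cycles of a relation on a finite type. -/
theorem eventually_hasProd_prime [Fintype α] [DecidableEq α] (R : α → α → Prop)
    [DecidableRel R] :
    ∀ᶠ u : ℂ in 𝓝 0, HasProd (fun p : Cycle.Prime R => (1 - u ^ p.1.length)⁻¹)
      (1 - u • relMatrix R).det⁻¹ := by
  have h1 : ∀ᶠ u : ℂ in 𝓝 0, ‖u‖ < 1 := by
    simpa using (continuous_norm.tendsto (0 : ℂ)).eventually_lt_const (by simp)
  have h2 : ∀ᶠ u : ℂ in 𝓝 0, ‖u‖ * Fintype.card α < 1 :=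
    (Continuous.tendsto (f := fun u : ℂ => ‖u‖ * Fintype.card α) (by fun_prop) 0).eventually_lt_const
      (by simp)
  filter_upwards [(relMatrix R).eventually_hasSum_trace_pow, h1, h2] with u ⟨L, hL, hexp⟩ hu hu'
  rw [← hexp]
  refine (hasSum_neg_log_prime (hasSum_neg_log_primitive hu
    (hasSum_closedPathTerm hu' hL))).cexp.congr_fun ?_
  rintro ⟨_, hc, c, rfl, hprim⟩
  have h0 : 1 - u ^ c.length ≠ 0 := by
    intro h
    have : ‖u ^ c.length‖ < 1 := by
      rw [norm_pow]
      exact pow_lt_one₀ (norm_nonneg u) hu hprim.length_pos.ne'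
    rw [← sub_eq_zero.1 h, norm_one] at this
    exact lt_irrefl _ this
  rw [Function.comp_apply, Cycle.length_coe, Complex.exp_neg, Complex.exp_log h0]

end Relation

/-! ### The determinant of the non-backtracking operator -/

namespace Matrix

/-- Both partial products `M * Mᵀ - 1` and `N * Nᵀ - 1` are low rank perturbations of scalars, so
two applications of the Weinstein-Aronszajn identity move the determinant from `ι` to `κ`. -/
theorem det_one_sub_smul_mul_sub_one {K ι κ μ : Type*} [Field K] [Fintype ι] [DecidableEq ι]
    [Fintype κ] [DecidableEq κ] [Fintype μ] [DecidableEq μ] (M : Matrix ι μ K) (N : Matrix ι κ K)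
    (d r u : K) (hM : Mᵀ * M = r • 1) (hN : Nᵀ * N = d • 1) (hu : 1 - u ≠ 0)
    (hru : 1 + (r - 1) * u ≠ 0) :
    (1 - u • ((M * Mᵀ - 1) * (N * Nᵀ - 1))).det =
      (1 - u) ^ ((Fintype.card ι : ℤ) - Fintype.card κ - Fintype.card μ) *
        (1 + (r - 1) * u) ^ ((Fintype.card μ : ℤ) - Fintype.card κ) *
        (((1 + (d - 1) * u) * (1 + (r - 1) * u)) • 1 - u • ((Nᵀ * M) * (Nᵀ * M)ᵀ)).det := by
  set a := 1 - u with ha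
  set b := 1 + (r - 1) * u with hb
  have hMM : (M * Mᵀ) * (M * Mᵀ) = r • (M * Mᵀ) := by
    rw [Matrix.mul_assoc, ← Matrix.mul_assoc Mᵀ, hM]
    simp
  -- `Z = 1 + u (M Mᵀ - 1)`, whose inverse is `(a b)⁻¹ Y` with `Y = b - u M Mᵀ`.
  set Z : Matrix ι ι K := a • 1 + u • (M * Mᵀ) with hZ
  set Y : Matrix ι ι K := b • 1 - u • (M * Mᵀ) with hY
  have hZY : Z * Y = (a * b) • 1 := by
    rw [hZ, hY, Matrix.add_mul, Matrix.mul_sub, Matrix.mul_sub]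
    simp only [smul_mul_smul_comm, Matrix.mul_one, Matrix.one_mul, hMM, smul_smul]
    have : u * b - a * u - u * u * r = 0 := by rw [ha, hb]; ring
    have h2 : (u * b) • (M * Mᵀ) - (a * u) • (M * Mᵀ) - (u * u * r) • (M * Mᵀ) = 0 := by
      rw [← sub_smul, ← sub_smul, this, zero_smul]
    rw [← sub_eq_zero, ← h2]
    abel
  have hfactor : 1 - u • ((M * Mᵀ - 1) * (N * Nᵀ - 1)) =
      Z * (1 - ((1 - (a * b)⁻¹ • Y) * N) * Nᵀ) := by
    have h1 : Z * (1 - (a * b)⁻¹ • Y) = Z - 1 := by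
      rw [Matrix.mul_sub, Matrix.mul_smul, hZY, smul_smul, inv_mul_cancel₀ (mul_ne_zero hu hru),
        one_smul, Matrix.mul_one]
    have h2 : Z - 1 = u • (M * Mᵀ - 1) := by
      rw [hZ, ha, sub_smul, one_smul, smul_sub]
      abel
    rw [← Matrix.smul_mul, ← h2, Matrix.mul_sub (Z - 1), Matrix.mul_one, Matrix.mul_sub Z,
      Matrix.mul_one, Matrix.mul_assoc _ N, ← Matrix.mul_assoc Z, h1]
    abel
  have hdetZ : Z.det = a ^ ((Fintype.card ι : ℤ) - Fintype.card μ) * b ^ Fintype.card μ := by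
    have h1 : Z = a • (1 + ((u / a) • M) * Mᵀ) := by
      rw [hZ, smul_add, Matrix.smul_mul, smul_smul, mul_div_cancel₀ _ hu]
    have h2 : (1 : Matrix μ μ K) + Mᵀ * ((u / a) • M) = (b / a) • 1 := by
      rw [Matrix.mul_smul, hM, smul_smul]
      have : b / a = 1 + u / a * r := by
        field_simp
        rw [ha, hb]
        ring
      rw [this, add_smul, one_smul]
    rw [h1, det_smul, det_one_add_mul_comm, h2, det_smul, det_one, mul_one, div_pow,
      zpow_sub₀ hu, zpow_natCast, zpow_natCast]
    field_simp
  have hinner : 1 - Nᵀ * ((1 - (a * b)⁻¹ • Y) * N) =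
      (a * b)⁻¹ • (((1 + (d - 1) * u) * b) • 1 - u • ((Nᵀ * M) * (Nᵀ * M)ᵀ)) := by
    have h1 : (Nᵀ * M) * (Nᵀ * M)ᵀ = Nᵀ * ((M * Mᵀ) * N) := by
      rw [transpose_mul, transpose_transpose]
      simp only [Matrix.mul_assoc]
    rw [h1, hY]
    simp only [Matrix.sub_mul, Matrix.mul_sub, Matrix.one_mul, Matrix.smul_mul, Matrix.mul_smul, hN,
      smul_sub, smul_smul]
    have h3 : (1 + (d - 1) * u) * b = a * b - a * b * d + b * d := by rw [ha]; ring
    have h4 : (a * b)⁻¹ * ((1 + (d - 1) * u) * b) = 1 - d + (a * b)⁻¹ * (b * d) := by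
      rw [h3]
      field_simp
    rw [h4, add_smul, sub_smul, one_smul, mul_assoc]
    abel
  rw [hfactor, det_mul, det_one_sub_mul_comm, hinner, det_smul, hdetZ, zpow_sub₀ hu, zpow_sub₀ hu,
    zpow_sub₀ hu, zpow_sub₀ hru]
  simp only [zpow_natCast, inv_pow, mul_pow]
  field_simp

theorem det_smul_one_sub_smul_mul_transpose {K κ μ : Type*} [Field K] [Fintype κ] [DecidableEq κ]
    [Fintype μ] [DecidableEq μ] (B : Matrix κ μ K) {s : K} (hs : s ≠ 0) (u : K) :
    (s • 1 - u • (B * Bᵀ)).det =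
      s ^ ((Fintype.card κ : ℤ) - Fintype.card μ) * (s • 1 - u • (Bᵀ * B)).det := by
  have h1 : s • 1 - u • (B * Bᵀ) = s • (1 - ((u / s) • B) * Bᵀ) := by
    rw [smul_sub, Matrix.smul_mul, smul_smul, mul_div_cancel₀ _ hs]
  have h2 : s • 1 - u • (Bᵀ * B) = s • (1 - Bᵀ * ((u / s) • B)) := by
    rw [smul_sub, Matrix.mul_smul, smul_smul, mul_div_cancel₀ _ hs]
  rw [h1, h2, det_smul, det_smul, det_one_sub_mul_comm, zpow_sub₀ hs, zpow_natCast, zpow_natCast]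
  field_simp

end Matrix

namespace MultiHypergraph

variable {V E : Type*} (H : MultiHypergraph V E)

/-! ### Prime cycles of a hypergraph -/

/-- A step of a path followed by a change of the hyperedge. -/
def IsNonBacktrackingStep (a b : V × E) : Prop :=
  H.IsStep a b ∧ a.2 ≠ b.2

variable {H}

/-- The double of a closed path has no hyperedge backtracking exactly when consecutive hyperedges of
the closed path, in the cyclic sense, are different. -/
theorem chain_isNonBacktrackingStep_iff {c : List (V × E)} (hc : c ≠ []) :
    Cycle.Chain H.IsNonBacktrackingStep (c : Cycle (V × E)) ↔
      Cycle.Chain H.IsStep (c : Cycle (V × E)) ∧ NoHyperedgeBacktracking c ∧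
        NoHyperedgeBacktracking (multiple 2 c) := by
  cases c with
  | nil => exact absurd rfl hc
  | cons x t =>
    have h2 : multiple 2 (x :: t) = x :: t ++ x :: t := by simp [multiple]
    rw [Cycle.chain_coe_cons, Cycle.chain_coe_cons, NoHyperedgeBacktracking,
      NoHyperedgeBacktracking, h2, List.isChain_split]
    constructor
    · intro h
      have hne : List.IsChain (fun a b : V × E => a.2 ≠ b.2) (x :: (t ++ [x])) :=
        h.imp fun _ _ hab => hab.2
      exact ⟨h.imp fun _ _ hab => hab.1, hne.prefix ⟨[x], rfl⟩, hne, hne.prefix ⟨[x], rfl⟩⟩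
    · rintro ⟨h, -, hne, -⟩
      exact List.isChain_iff_getElem.2 fun i hi =>
        ⟨List.isChain_iff_getElem.1 h i hi, List.isChain_iff_getElem.1 hne i hi⟩

theorem isPrimitiveCycle_iff {c : List (V × E)} :
    H.IsPrimitiveCycle c ↔
      Cycle.Chain H.IsNonBacktrackingStep (c : Cycle (V × E)) ∧ c.IsPrimitive := by
  constructor
  · rintro ⟨⟨hne, hc⟩, h1, h2, h⟩
    refine ⟨(chain_isNonBacktrackingStep_iff hne).2 ⟨hc, h1, h2⟩, hne, ?_⟩
    rintro b m hm rfl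
    obtain ⟨k, rfl⟩ := Nat.exists_eq_add_of_le' (one_le_two.trans hm)
    refine h b (k + 1) ⟨?_, (Cycle.chain_coe_flatten_replicate b k).1 hc⟩ hm rfl
    rintro rfl
    simp at hne
  · rintro ⟨hc, hp⟩
    obtain ⟨h, h1, h2⟩ := (chain_isNonBacktrackingStep_iff hp.1).1 hc
    exact ⟨⟨hp.1, h⟩, h1, h2, fun b m _ hm => hp.2 b m hm⟩

variable (H) in
/-- The prime cycles of a hypergraph are those of its non-backtracking step relation. -/
def primeCycleEquiv : H.PrimeCycle ≃ Cycle.Prime H.IsNonBacktrackingStep :=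
  Equiv.subtypeEquivRight fun C => by
    simp only [isPrimitiveCycle_iff]
    constructor
    · rintro ⟨c, rfl, hc, hp⟩
      exact ⟨hc, c, rfl, hp⟩
    · rintro ⟨hc, c, rfl, hp⟩
      exact ⟨c, rfl, hc, hp⟩

theorem eventually_hasProd_zeta [Fintype V] [DecidableEq V] [Fintype E] [DecidableEq E]
    [DecidableRel H.IsNonBacktrackingStep] :
    ∀ᶠ u : ℂ in 𝓝 0, HasProd (fun p : H.PrimeCycle => (1 - u ^ p.length)⁻¹)
      (1 - u • relMatrix H.IsNonBacktrackingStep).det⁻¹ := by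
  filter_upwards [eventually_hasProd_prime H.IsNonBacktrackingStep] with u hu
  exact H.primeCycleEquiv.hasProd_iff.2 hu

/-! ### Incidence matrices -/

variable (H) in
/-- The incident pairs of a hypervertex and a hyperedge, that is, the edges of the bipartite
graph. -/
abbrev Flag : Type _ :=
  {x : V × E // x.1 ∈ H.edge x.2}

variable (H) in
/-- The incidence matrix of a hypergraph. -/
noncomputable def incMatrix : Matrix V E ℂ :=
  open Classical in Matrix.of fun v e => if v ∈ H.edge e then 1 else 0

theorem incMatrix_dual : H.dual.incMatrix = H.incMatrixᵀ :=
  rfl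

variable (H) in
/-- The incidence matrix between flags and hypervertices. -/
def flagVertexMatrix [DecidableEq V] : Matrix H.Flag V ℂ :=
  Matrix.of fun x v => if x.1.1 = v then 1 else 0

variable (H) in
/-- The incidence matrix between flags and hyperedges. -/
def flagEdgeMatrix [DecidableEq E] : Matrix H.Flag E ℂ :=
  Matrix.of fun x e => if x.1.2 = e then 1 else 0

open Classical in
theorem sum_flag [Fintype V] [Fintype E] [Fintype H.Flag] {M : Type*} [AddCommMonoid M]
    (f : V × E → M) :
    ∑ x : H.Flag, f x.1 = ∑ v, ∑ e, if v ∈ H.edge e then f (v, e) else 0 := by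
  rw [← Fintype.sum_prod_type' (f := fun v e => if v ∈ H.edge e then f (v, e) else 0),
    ← Finset.sum_filter]
  exact (Finset.sum_subtype _ (by simp) f).symm

open Classical in
theorem IsRegular.sum_edge [Fintype E] {d r : ℕ} (h : H.IsRegular d r) {R : Type*}
    [NonAssocSemiring R] (v : V) : ∑ e, (if v ∈ H.edge e then 1 else 0 : R) = d := by
  rw [← h.1 v, Set.ncard_eq_toFinset_card', Finset.sum_boole, Set.toFinset_ofPred]

open Classical in
theorem IsRegular.sum_vertex [Fintype V] {d r : ℕ} (h : H.IsRegular d r) {R : Type*}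
    [NonAssocSemiring R] (e : E) : ∑ v, (if v ∈ H.edge e then 1 else 0 : R) = r := by
  rw [← h.2 e, Set.ncard_eq_toFinset_card', Finset.sum_boole]
  congr 2
  ext
  simp

theorem IsRegular.dual {d r : ℕ} (h : H.IsRegular d r) : H.dual.IsRegular r d :=
  ⟨h.2, h.1⟩

theorem IsRegular.card_flag [Fintype V] [Fintype E] [Fintype H.Flag] {d r : ℕ}
    (h : H.IsRegular d r) : Fintype.card H.Flag = Fintype.card V * d := by
  classical
  have h1 := H.sum_flag fun _ => (1 : ℕ)
  simp only [h.sum_edge] at h1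
  simpa using h1

/-- The count of the flags by hyperedges. -/
theorem IsRegular.card_flag' [Fintype V] [Fintype E] [Fintype H.Flag] {d r : ℕ}
    (h : H.IsRegular d r) : Fintype.card H.Flag = Fintype.card E * r := by
  classical
  have h1 := H.sum_flag fun _ => (1 : ℕ)
  rw [Finset.sum_comm] at h1
  simp only [h.sum_vertex] at h1
  simpa using h1

theorem ncard_edgeSet_bipartiteGraph [Fintype H.Flag] :
    H.bipartiteGraph.edgeSet.ncard = Fintype.card H.Flag := by
  rw [← Nat.card_coe_set_eq, ← Nat.card_eq_fintype_card]
  refine (Nat.card_congr (Equiv.ofBijective (fun x : H.Flag =>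
    (⟨s(Sum.inl x.1.1, Sum.inr x.1.2), x.2⟩ : H.bipartiteGraph.edgeSet)) ⟨?_, ?_⟩)).symm
  · rintro ⟨⟨v, e⟩, hx⟩ ⟨⟨w, f⟩, hy⟩ h
    simpa using congrArg Subtype.val h
  · rintro ⟨z, hz⟩
    induction z using Sym2.ind with
    | _ x y =>
      rcases x with v | e <;> rcases y with w | f
      · exact hz.elim
      · exact ⟨⟨(v, f), hz⟩, rfl⟩
      · exact ⟨⟨(w, e), hz⟩, Subtype.ext Sym2.eq_swap⟩
      · exact hz.elim

theorem neg_eulerNumber [Fintype V] [Fintype E] [Fintype H.Flag] :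
    -H.eulerNumber = (Fintype.card H.Flag : ℤ) - Fintype.card V - Fintype.card E := by
  rw [eulerNumber, ncard_edgeSet_bipartiteGraph, Nat.card_eq_fintype_card, Fintype.card_sum]
  push_cast
  ring

theorem IsRegular.flagVertexMatrix_transpose_mul_self [Fintype V] [DecidableEq V] [Fintype E]
    [Fintype H.Flag] {d r : ℕ} (h : H.IsRegular d r) :
    H.flagVertexMatrixᵀ * H.flagVertexMatrix = (d : ℂ) • 1 := by
  classical
  ext v w
  rw [Matrix.mul_apply]
  refine (H.sum_flag fun x => (if x.1 = v then 1 else 0) * (if x.1 = w then 1 else 0)).trans ?_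
  rw [Finset.sum_eq_single v (by intro b _ hb; simp [hb]) (by simp)]
  by_cases hvw : v = w
  · simpa [hvw] using h.sum_edge (R := ℂ) w
  · simp [hvw]

theorem IsRegular.flagEdgeMatrix_transpose_mul_self [Fintype V] [Fintype E] [DecidableEq E]
    [Fintype H.Flag] {d r : ℕ} (h : H.IsRegular d r) :
    H.flagEdgeMatrixᵀ * H.flagEdgeMatrix = (r : ℂ) • 1 := by
  classical
  ext e f
  rw [Matrix.mul_apply]
  refine (H.sum_flag fun x => (if x.2 = e then 1 else 0) * (if x.2 = f then 1 else 0)).trans ?_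
  rw [Finset.sum_comm, Finset.sum_eq_single e (by intro b _ hb; simp [hb]) (by simp)]
  by_cases hef : e = f
  · simpa [hef] using h.sum_vertex (R := ℂ) f
  · simp [hef]

theorem flagVertexMatrix_transpose_mul_flagEdgeMatrix [Fintype V] [DecidableEq V] [Fintype E]
    [DecidableEq E] [Fintype H.Flag] :
    H.flagVertexMatrixᵀ * H.flagEdgeMatrix = H.incMatrix := by
  classical
  ext v e
  rw [Matrix.mul_apply]
  refine (H.sum_flag fun x => (if x.1 = v then 1 else 0) * (if x.2 = e then 1 else 0)).trans ?_
  rw [Finset.sum_eq_single v (by intro b _ hb; simp [hb]) (by simp),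
    Finset.sum_eq_single e (by intro b _ hb; simp [hb]) (by simp)]
  simp [incMatrix]

theorem IsRegular.incMatrix_mul_transpose [DecidableEq V] [Fintype E] {d r : ℕ}
    (h : H.IsRegular d r) : H.incMatrix * H.incMatrixᵀ = H.adjMatrix + (d : ℂ) • 1 := by
  classical
  ext i j
  rw [Matrix.mul_apply]
  simp only [incMatrix, Matrix.transpose_apply, Matrix.of_apply, adjMatrix, Matrix.add_apply,
    Matrix.smul_apply, smul_eq_mul]
  by_cases hij : i = j
  · subst hij
    rw [Matrix.one_apply_eq, mul_one, ← h.sum_edge i]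
    simp only [ne_eq, not_true_eq_false, and_false, Set.ofPred_false, Set.ncard_empty,
      Nat.cast_zero, zero_add]
    refine Finset.sum_congr rfl fun e _ => ?_
    split_ifs <;> simp
  · have hset : {x | H.bipartiteGraph.Adj (Sum.inl i) x ∧ H.bipartiteGraph.Adj x (Sum.inl j) ∧
        i ≠ j} = Sum.inr '' {e | i ∈ H.edge e ∧ j ∈ H.edge e} := by
      ext x
      rcases x with v | e
      · simp [bipartiteGraph]
      · simp [bipartiteGraph, hij]
    rw [hset, Set.ncard_image_of_injective _ Sum.inr_injective, Set.ncard_eq_toFinset_card',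
      Set.toFinset_ofPred, Matrix.one_apply_ne hij, mul_zero, add_zero, ← Finset.sum_boole]
    refine Finset.sum_congr rfl fun e _ => ?_
    by_cases hi : i ∈ H.edge e <;> by_cases hj : j ∈ H.edge e <;> simp [hi, hj]

/-- The matrix of non-backtracking steps, restricted to flags, is the product of the steps that
change the hypervertex within a hyperedge and those that change the hyperedge at a hypervertex. -/
theorem relMatrix_flag [Fintype V] [DecidableEq V] [Fintype E] [DecidableEq E] [Fintype H.Flag]
    [DecidableRel H.IsNonBacktrackingStep] (x y : H.Flag) :
    relMatrix H.IsNonBacktrackingStep x.1 y.1 =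
      ((H.flagEdgeMatrix * H.flagEdgeMatrixᵀ - 1) *
        (H.flagVertexMatrix * H.flagVertexMatrixᵀ - 1) : Matrix H.Flag H.Flag ℂ) x y := by
  classical
  obtain ⟨⟨v, e⟩, hx⟩ := x
  obtain ⟨⟨w, f⟩, hy⟩ := y
  have hE (z t : H.Flag) : (H.flagEdgeMatrix * H.flagEdgeMatrixᵀ - 1 : Matrix H.Flag H.Flag ℂ) z t =
      if z.1.2 = t.1.2 ∧ z.1.1 ≠ t.1.1 then 1 else 0 := by
    rw [Matrix.sub_apply, Matrix.mul_apply]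
    by_cases h2 : z.1.2 = t.1.2 <;> by_cases h1 : z.1.1 = t.1.1 <;>
      simp [flagEdgeMatrix, Matrix.one_apply, Subtype.ext_iff, Prod.ext_iff, h1, h2, eq_comm]
  have hV (z t : H.Flag) :
      (H.flagVertexMatrix * H.flagVertexMatrixᵀ - 1 : Matrix H.Flag H.Flag ℂ) z t =
      if z.1.1 = t.1.1 ∧ z.1.2 ≠ t.1.2 then 1 else 0 := by
    rw [Matrix.sub_apply, Matrix.mul_apply]
    by_cases h2 : z.1.2 = t.1.2 <;> by_cases h1 : z.1.1 = t.1.1 <;>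
      simp [flagVertexMatrix, Matrix.one_apply, Subtype.ext_iff, Prod.ext_iff, h1, h2, eq_comm]
  rw [Matrix.mul_apply]
  simp only [hE, hV]
  refine Eq.symm ((H.sum_flag fun z => (if e = z.2 ∧ v ≠ z.1 then 1 else 0) *
    (if z.1 = w ∧ z.2 ≠ f then 1 else 0)).trans ?_)
  rw [Finset.sum_eq_single w (by intro b _ hb; simp [hb]) (by simp),
    Finset.sum_eq_single e (by intro b _ hb; simp [hb.symm]) (by simp)]
  have hx' : v ∈ H.edge e := hx
  simp only [relMatrix, Matrix.of_apply, IsNonBacktrackingStep, IsStep, hx']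
  by_cases h1 : w ∈ H.edge e <;> by_cases h2 : v = w <;> by_cases h3 : e = f <;> simp [h1, h2, h3]

/-- Pairs that are not incident have no non-backtracking steps out of them, so the determinant only
depends on the flags. -/
theorem det_one_sub_smul_relMatrix [Fintype V] [DecidableEq V] [Fintype E] [DecidableEq E]
    [Fintype H.Flag] [DecidableRel H.IsNonBacktrackingStep] (u : ℂ) :
    (1 - u • relMatrix H.IsNonBacktrackingStep).det =
      (1 - u • ((H.flagEdgeMatrix * H.flagEdgeMatrixᵀ - 1) *
        (H.flagVertexMatrix * H.flagVertexMatrixᵀ - 1)) : Matrix H.Flag H.Flag ℂ).det := by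
  classical
  have hzero (i j : V × E) (hi : ¬ i.1 ∈ H.edge i.2) :
      relMatrix H.IsNonBacktrackingStep i j = 0 :=
    if_neg fun h => hi h.1.1
  rw [Matrix.twoBlockTriangular_det _ fun x : V × E => x.1 ∈ H.edge x.2]
  · have h2 : Matrix.toSquareBlockProp (1 - u • relMatrix H.IsNonBacktrackingStep)
        (fun x : V × E => ¬ x.1 ∈ H.edge x.2) = 1 := by
      ext i j
      simp [Matrix.toSquareBlockProp, hzero _ _ i.2, Matrix.one_apply, Subtype.ext_iff]
    rw [h2, Matrix.det_one, mul_one]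
    convert rfl using 2
    ext i j
    rw [Matrix.sub_apply, Matrix.smul_apply, ← relMatrix_flag]
    simp [Matrix.toSquareBlockProp, Matrix.one_apply, Subtype.ext_iff]
  · intro i hi j hj
    have hij : i ≠ j := by
      rintro rfl
      exact hi hj
    simp [hzero i j hi, hij]

/-- As `A = B Bᵀ - d`, the scalar part of the matrix is `1 + (d + r - 2) u + (d - 1) (r - 1) u ^ 2`,
which factors. -/
theorem IsRegular.det_adjMatrix [Fintype V] [DecidableEq V] [Fintype E] {d r : ℕ}
    (h : H.IsRegular d r) (u : ℂ) :
    ((1 : Matrix V V ℂ) - u • (H.adjMatrix - ((r : ℂ) - 2) • (1 : Matrix V V ℂ))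
      + (((d : ℂ) - 1) * ((r : ℂ) - 1) * u ^ 2) • (1 : Matrix V V ℂ)).det =
      (((1 + ((d : ℂ) - 1) * u) * (1 + ((r : ℂ) - 1) * u)) • 1 -
        u • (H.incMatrix * H.incMatrixᵀ)).det := by
  congr 1
  rw [h.incMatrix_mul_transpose]
  module

end MultiHypergraph

theorem mainTheorem3 {V E : Type*} [Fintype V] [DecidableEq V] [Fintype E] [DecidableEq E]
    (H : MultiHypergraph V E) (hconn : H.Connected) (d r : ℕ) (hreg : H.IsRegular d r)
    (hdr : r ≤ d) (n₁ n₂ : ℤ) (hn₁ : n₁ = Fintype.card V) (hn₂ : n₂ = Fintype.card E)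
    (q : ℂ) (hq : q = ((d : ℂ) - 1) * ((r : ℂ) - 1)) :
    (-H.eulerNumber = n₁ * ((d : ℤ) - 1) - n₂ ∧ -H.eulerNumber = n₂ * ((r : ℤ) - 1) - n₁) ∧
    ∀ᶠ u : ℂ in 𝓝 0,
      Multipliable (fun p : H.PrimeCycle => (1 - u ^ p.length)⁻¹) ∧
      (H.zeta u)⁻¹ =
        (1 - u) ^ (-H.eulerNumber) * (1 + ((r : ℂ) - 1) * u) ^ (n₂ - n₁) *
          Matrix.det ((1 : Matrix V V ℂ)
            - u • (H.adjMatrix - ((r : ℂ) - 2) • (1 : Matrix V V ℂ))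
            + (q * u ^ 2) • (1 : Matrix V V ℂ)) ∧
      (H.zeta u)⁻¹ =
        (1 - u) ^ (-H.eulerNumber) * (1 + ((d : ℂ) - 1) * u) ^ (n₁ - n₂) *
          Matrix.det ((1 : Matrix E E ℂ)
            - u • (H.dual.adjMatrix - ((d : ℂ) - 2) • (1 : Matrix E E ℂ))
            + (q * u ^ 2) • (1 : Matrix E E ℂ)) := by
  classical
  subst hn₁ hn₂ hq
  refine ⟨⟨?_, ?_⟩, ?_⟩
  · rw [MultiHypergraph.neg_eulerNumber, hreg.card_flag]
    push_cast
    ring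
  · rw [MultiHypergraph.neg_eulerNumber, hreg.card_flag']
    push_cast
    ring
  have hne (f : ℂ → ℂ) (hf : Continuous f) (h0 : f 0 ≠ 0) : ∀ᶠ u in 𝓝 0, f u ≠ 0 :=
    hf.continuousAt.eventually_ne h0
  filter_upwards [H.eventually_hasProd_zeta, hne (fun u => 1 - u) (by fun_prop) (by simp),
    hne (fun u => 1 + ((r : ℂ) - 1) * u) (by fun_prop) (by simp),
    hne (fun u => 1 + ((d : ℂ) - 1) * u) (by fun_prop) (by simp)] with u hprod hu hru hdu
  have hzeta : (H.zeta u)⁻¹ = (1 - u) ^ (-H.eulerNumber) *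
      (1 + ((r : ℂ) - 1) * u) ^ ((Fintype.card E : ℤ) - Fintype.card V) *
      (((1 + ((d : ℂ) - 1) * u) * (1 + ((r : ℂ) - 1) * u)) • 1 -
        u • (H.incMatrix * H.incMatrixᵀ)).det := by
    rw [MultiHypergraph.zeta, hprod.tprod_eq, inv_inv,
      MultiHypergraph.det_one_sub_smul_relMatrix, MultiHypergraph.neg_eulerNumber,
      Matrix.det_one_sub_smul_mul_sub_one _ _ _ _ _ hreg.flagEdgeMatrix_transpose_mul_self
        hreg.flagVertexMatrix_transpose_mul_self hu hru,
      MultiHypergraph.flagVertexMatrix_transpose_mul_flagEdgeMatrix]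
  refine ⟨hprod.multipliable, ?_, ?_⟩
  · rw [hzeta, hreg.det_adjMatrix]
  · rw [hzeta, mul_comm ((d : ℂ) - 1) ((r : ℂ) - 1), hreg.dual.det_adjMatrix,
      MultiHypergraph.incMatrix_dual, Matrix.transpose_transpose,
      mul_comm (1 + ((r : ℂ) - 1) * u) (1 + ((d : ℂ) - 1) * u),
      Matrix.det_smul_one_sub_smul_mul_transpose _ (mul_ne_zero hdu hru), mul_zpow]
    have hcancel : (1 + ((r : ℂ) - 1) * u) ^ ((Fintype.card E : ℤ) - Fintype.card V) *
        (1 + ((r : ℂ) - 1) * u) ^ ((Fintype.card V : ℤ) - Fintype.card E) = 1 := by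
      rw [← zpow_add₀ hru]
      simp
    linear_combination (1 - u) ^ (-H.eulerNumber) *
      (1 + ((d : ℂ) - 1) * u) ^ ((Fintype.card V : ℤ) - Fintype.card E) *
      (((1 + ((d : ℂ) - 1) * u) * (1 + ((r : ℂ) - 1) * u)) • 1 -
        u • (H.incMatrixᵀ * H.incMatrix)).det * hcancel
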